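/- Let $d\ge 1$, let $a,b\in\mathbb R^d$ with $a_i\le b_i$ for all $i$, let $\mathcal R=\prod_{i=1}^d[a_i,b_i]$, and let $0\le M<\infty$. For $f:\mathcal R\to\mathbb R$ and $x,y\in\mathcal R$ put $\Delta(f;x,y)=\sum_{v\subseteq\{1,\dots,d\}}(-1)^{|v|}f(x^v:y^{-v})$, where $x^v:y^{-v}$ has the coordinates of $x$ on $v$ and those of $y$ off $v$. A ladder on $[a_i,b_i]$ is a finite sequence of points increasing from $a_i$ to $b_i$; one ladder for each coordinate gives a grid $\mathcal Y$ in $\mathcal R$ with cells $[y,y^+]$. The Vitali variation of $f$ is $V_{\mathbf V}(f)=\sup_{\mathcal Y}\sum_{y}|\Delta(f;y,y^+)|$, and its Hardy–Krause variation is $V_{\mathbf{HK}}(f)=\sum_{\varnothing\ne u\subseteq\{1,\dots,d\}}V_{\mathbf V}\big(x^u\mapsto f(x^u:b^{-u})\big)$. Let $BV(\mathcal R)=\{f: V_{\mathbf{HK}}(f)<\infty\}$ and $BV_M(\mathcal R)=\{f:V_{\mathbf{HK}}(f)\le M\}$; these are regarded as subsets of the space $\ell^\infty(\mathcal R)$ of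 bounded functions, and both $C(\mathcal R)$ and $\ell^\infty(\mathcal R)$ carry the supremum norm. Let $\int A\,dB$ denote the Riemann–Stieltjes integral over $\mathcal R$, i.e. the limit of the sums $\sum_y A(\xi_y)\,\Delta(B;y,y^+)$ over grids whose mesh tends to $0$, where the tags are $\xi_y=(\xi^1_{y_1},\dots,\xi^d_{y_d})$ with $\xi^i_{y_i}\in[y_i,y_i^+]$ chosen separately in each coordinate. Then $\phi(A,B)=\int A\,dB$ exists for all $A\in C(\mathcal R)$ and $B\in BV(\mathcal R)$. Moreover, the map $$\phi: C(\mathcal R)\times BV_M(\mathcal R)\subset C(\mathcal R)\times\ell^\infty(\mathcal R)\to\mathbb R$$ is Hadamard differentiable at every $(A,B)\in C(\mathcal R)\times BV_M(\mathcal R)$ such that $A$ has bounded Hardy–Krause variation. That is, there is a continuous linear map $\phi'_{A,B}:C(\mathcal R)\times\ell^\infty(\mathcal R)\to\mathbb R$ such that $$\frac{\phi(A+t_n\alpha_n,\,B+t_n\beta_n)-\phi(A,B)}{t_n}\to\phi'_{A,B}(\alpha,\beta)$$ whenever $0\neq t_n\to0$, $\alpha_n\to\alpha$ in $C(\mathcal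 R)$, $\beta_n\to\beta$ in $\ell^\infty(\mathcal R)$ and $B+t_n\beta_n\in BV_M(\mathcal R)$ for all $n$. For every $\alpha\in C(\mathcal R)$ and every $\beta$ in the closure of $BV(\mathcal R)$ in $\ell^\infty(\mathcal R)$ (which contains every $\beta$ that can arise as such a limit), the integrals below exist and $$\phi'_{A,B}(\alpha,\beta)=\int A\,d\beta+\int\alpha\,dB .$$ -/

import Mathlib

open Filter Topology
open scoped NNReal ENNReal

namespace HardyKrause

/-- Hadamard differentiability of a map `φ` with domain `Dφ ⊆ E` at the point `θ`, tangentially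
to `D₀ ⊆ E`, with derivative the continuous linear map `φ'`. For `D₀ = Set.univ` this is plain
Hadamard differentiability. -/
def HasHadamardDeriv {E F : Type*} [NormedAddCommGroup E] [NormedSpace ℝ E]
    [NormedAddCommGroup F] [NormedSpace ℝ F]
    (φ : E → F) (Dφ D₀ : Set E) (θ : E) (φ' : E →L[ℝ] F) : Prop :=
  ∀ (t : ℕ → ℝ) (h : ℕ → E) (h₀ : E), h₀ ∈ D₀ →
    (∀ n, t n ≠ 0) → Tendsto t atTop (𝓝 0) → Tendsto h atTop (𝓝 h₀) →
    (∀ n, θ + t n • h n ∈ Dφ) →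
    Tendsto (fun n => (t n)⁻¹ • (φ (θ + t n • h n) - φ θ)) atTop (𝓝 (φ' h₀))

/-- A ladder on `[s, t]`: finitely many points `s = pt 0 ≤ pt 1 ≤ ⋯ ≤ pt size = t`; the successor
of `pt k` is `pt (k + 1)`. (Repeated points only contribute zero increments, and the values
`pt k` for `k > size` are never used.) -/
structure Ladder (s t : ℝ) where
  size : ℕ
  pt : ℕ → Set.Icc s t
  mono : Monotone pt
  pt_zero : (pt 0 : ℝ) = s
  pt_size : (pt size : ℝ) = t

/-- A ladder together with one tag in each of its intervals `[pt k, pt (k + 1)]`. -/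
structure TaggedLadder (s t : ℝ) extends Ladder s t where
  tag : ℕ → Set.Icc s t
  pt_le_tag : ∀ k < size, pt k ≤ tag k
  tag_le_pt : ∀ k < size, tag k ≤ pt (k + 1)

section

variable {ι : Type*} [Fintype ι] [DecidableEq ι] {a b : ι → ℝ}

/-- The point of the hyperrectangle with the given coordinates. -/
def boxPoint (c : ∀ i, Set.Icc (a i) (b i)) : Set.Icc a b :=
  ⟨fun i => c i, fun i => (c i).2.1, fun i => (c i).2.2⟩

/-- The concatenation `x^v : z^{-v}`: coordinates of `x` on `v` and of `z` off `v`. -/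
def concat (v : Finset ι) (x z : Set.Icc a b) : Set.Icc a b :=
  ⟨fun i => if i ∈ v then x.1 i else z.1 i,
    fun i => by
      by_cases h : i ∈ v
      · simpa [h] using x.2.1 i
      · simpa [h] using z.2.1 i,
    fun i => by
      by_cases h : i ∈ v
      · simpa [h] using x.2.2 i
      · simpa [h] using z.2.2 i⟩

/-- The alternating sum `Δ(f; x, y) = ∑_v (-1)^{|v|} f(x^v : y^{-v})`. -/
def increment (f : Set.Icc a b → ℝ) (x y : Set.Icc a b) : ℝ :=
  ∑ v : Finset ι, (-1 : ℝ) ^ v.card * f (concat v x y)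

/-- The multi-indices of the cells of the grid formed by one ladder for each coordinate. -/
def cells (Y : ∀ i, Ladder (a i) (b i)) : Finset (ι → ℕ) :=
  Fintype.piFinset fun i => Finset.range (Y i).size

/-- The grid point `y` with multi-index `k`. -/
def gridPoint (Y : ∀ i, Ladder (a i) (b i)) (k : ι → ℕ) : Set.Icc a b :=
  boxPoint fun i => (Y i).pt (k i)

/-- The variation of `f` over the grid `Y`: the sum of `|Δ(f; y, y⁺)|`. -/
noncomputable def gridVariation (f : Set.Icc a b → ℝ) (Y : ∀ i, Ladder (a i) (b i)) : ℝ :=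
  ∑ k ∈ cells Y, |increment f (gridPoint Y k) (gridPoint Y fun i => k i + 1)|

/-- The variation of `f` in the sense of Vitali. -/
noncomputable def vitaliVariation (f : Set.Icc a b → ℝ) : ℝ≥0∞ :=
  ⨆ Y : ∀ i, Ladder (a i) (b i), ENNReal.ofReal (gridVariation f Y)

/-- The function `x^u ↦ f(x^u : b^{-u})` on the hyperrectangle `∏_{i ∈ u} [a i, b i]`. -/
def faceRestrict (hab : a ≤ b) (f : Set.Icc a b → ℝ) (u : Finset ι) :
    Set.Icc (fun i : u => a i) (fun i : u => b i) → ℝ :=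
  fun x => f (boxPoint fun i =>
    if h : i ∈ u then ⟨x.1 ⟨i, h⟩, x.2.1 ⟨i, h⟩, x.2.2 ⟨i, h⟩⟩ else ⟨b i, hab i, le_rfl⟩)

/-- The variation of `f` in the sense of Hardy and Krause (anchored at the upper corner `b`). -/
noncomputable def hkVariation (hab : a ≤ b) (f : Set.Icc a b → ℝ) : ℝ≥0∞ :=
  ∑ u : Finset ι with u.Nonempty, vitaliVariation (faceRestrict hab f u)

/-- The Riemann-Stieltjes sum `∑_y A(ξ_y) Δ(B; y, y⁺)` over a tagged grid. -/
noncomputable def rsSum (A B : Set.Icc a b → ℝ) (P : ∀ i, TaggedLadder (a i) (b i)) : ℝ :=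
  ∑ k ∈ cells (fun i => (P i).toLadder),
    A (boxPoint fun i => (P i).tag (k i)) *
      increment B (gridPoint (fun i => (P i).toLadder) k)
        (gridPoint (fun i => (P i).toLadder) fun i => k i + 1)

/-- `I` is the Riemann-Stieltjes integral `∫ A dB` over the hyperrectangle: the limit of the
Riemann-Stieltjes sums as the mesh of the tagged grid tends to zero. -/
def HasRSIntegral (A B : Set.Icc a b → ℝ) (I : ℝ) : Prop :=
  ∀ ε > 0, ∃ δ > 0, ∀ P : ∀ i, TaggedLadder (a i) (b i),
    (∀ i, ∀ k < (P i).size, ((P i).pt (k + 1) : ℝ) - (P i).pt k < δ) →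
      |rsSum A B P - I| < ε

open Classical in
/-- The Riemann-Stieltjes integral `∫ A dB` (zero if it does not exist). -/
noncomputable def rsIntegral (A B : Set.Icc a b → ℝ) : ℝ :=
  if h : ∃ I, HasRSIntegral A B I then h.choose else 0

end

/-- The space `ℓ^∞` of bounded real functions on the hyperrectangle, with the supremum norm. -/
abbrev BoundedFun {d : ℕ} (a b : Fin d → ℝ) : Type :=
  lp (fun _ : Set.Icc a b => ℝ) ∞

/-- The domain `C(R) × BV_M(R)` of the integration map, as a subset of `C(R) × ℓ^∞(R)`. -/
def integrationDomain {d : ℕ} {a b : Fin d → ℝ} (hab : a ≤ b) (M : ℝ≥0) :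
    Set (C(Set.Icc a b, ℝ) × BoundedFun a b) :=
  {p | hkVariation hab (p.2 : Set.Icc a b → ℝ) ≤ M}

/-- The integration map `φ(A, B) = ∫ A dB`. -/
noncomputable def integrationMap {d : ℕ} {a b : Fin d → ℝ}
    (p : C(Set.Icc a b, ℝ) × BoundedFun a b) : ℝ :=
  rsIntegral p.1 p.2

end HardyKrause

/-!
Multivariate linear identities between values of a function at finitely many points follow from
their one-dimensional cases: indicators of points are products of functions of one coordinate, so
such an identity need only be checked on products (`eq_of_eq_on_prodFun`), where increments over
cells factor (`increment_prodFun`). Two identities are obtained in this way.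

* The increment over a cell is the sum of the increments over the cells of a refinement
  (`sum_cells_eq_of_refines`). Hence two Riemann-Stieltjes sums over fine grids, compared on a common
  refinement, differ by at most the oscillation of the integrand times the Vitali variation of the
  integrator (`abs_rsSum_sub_le`). This gives existence of `∫ A dB` for continuous `A`, with a rate
  that is uniform over integrators of bounded variation (`HasRSIntegral.abs_rsSum_sub_le`).
* Summation by parts (`rsSum_by_parts`) shows that `|∫ A dβ| ≤ K ‖β‖` for the supremum norm, with
  `K` depending only on the value of `A` at `b` and its Hardy-Krause variation
  (`exists_abs_rsSum_le_of_hkVariation`).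

With `Bₙ = B + tₙ βₙ`, the difference quotient of the integration map is `∫ A dβₙ + ∫ αₙ dBₙ`. The
first term converges by the second estimate. In the second term, `∫ αₙ dBₙ` is uniformly close to a
Riemann-Stieltjes sum over a fixed grid, which depends continuously on the values of `Bₙ`
(`tendsto_rsIntegral`). The functional `β ↦ ∫ A dβ` is extended to all bounded `β` by a limit of
Riemann-Stieltjes sums along an ultrafilter; this limit is an honest one on the closure of the
functions for which the integral exists (`exists_generalized_limit`).
-/

namespace HardyKrause

/-! ### Increments and product functions -/

section Algebra

variable {ι : Type*} [Fintype ι] [DecidableEq ι] {a b : ι → ℝ}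

/-- The `i`-th coordinate of a point of the hyperrectangle, as a point of `[a i, b i]`. -/
def coord (x : Set.Icc a b) (i : ι) : Set.Icc (a i) (b i) := ⟨x.1 i, x.2.1 i, x.2.2 i⟩

omit [Fintype ι] [DecidableEq ι] in
@[simp] theorem coord_boxPoint (c : ∀ i, Set.Icc (a i) (b i)) (i : ι) :
    coord (boxPoint c) i = c i := rfl

omit [Fintype ι] [DecidableEq ι] in
theorem ext_coord {x y : Set.Icc a b} (h : ∀ i, coord x i = coord y i) : x = y :=
  Subtype.ext (funext fun i => congrArg Subtype.val (h i))

omit [Fintype ι] in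
@[simp] theorem coord_concat (v : Finset ι) (x z : Set.Icc a b) (i : ι) :
    coord (concat v x z) i = if i ∈ v then coord x i else coord z i := by
  apply Subtype.ext
  by_cases h : i ∈ v <;> simp [coord, concat, h]

/-- The product function `x ↦ ∏ i, g i (x i)`. -/
def prodFun (g : ∀ i, Set.Icc (a i) (b i) → ℝ) (x : Set.Icc a b) : ℝ := ∏ i, g i (coord x i)

theorem increment_prodFun (g : ∀ i, Set.Icc (a i) (b i) → ℝ) (x y : Set.Icc a b) :
    increment (prodFun g) x y = ∏ i, (g i (coord y i) - g i (coord x i)) := by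
  have h : ∀ i, g i (coord y i) - g i (coord x i) = -g i (coord x i) + g i (coord y i) :=
    fun i => by ring
  simp_rw [h, Finset.prod_add, increment, Finset.powerset_univ]
  refine Finset.sum_congr rfl fun v _ => ?_
  rw [Finset.prod_neg, mul_assoc, prodFun, ← Finset.prod_mul_prod_compl v,
    Finset.compl_eq_univ_sdiff]
  congr 2
  · exact Finset.prod_congr rfl fun i hi => by simp [hi]
  · exact Finset.prod_congr rfl fun i hi => by
      simp [(Finset.mem_sdiff.1 hi).2]

/-- The functionals on functions that are finite linear combinations of point evaluations. -/
def evalSpan (X : Type*) : Submodule ℝ ((X → ℝ) → ℝ) :=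
  Submodule.span ℝ (Set.range fun (x : X) (f : X → ℝ) => f x)

theorem eval_mem_evalSpan {X : Type*} (x : X) : (fun f : X → ℝ => f x) ∈ evalSpan X :=
  Submodule.subset_span ⟨x, rfl⟩

theorem mul_mem_evalSpan {X : Type*} {T : (X → ℝ) → ℝ} (hT : T ∈ evalSpan X) (c : ℝ) :
    (fun f => c * T f) ∈ evalSpan X :=
  (evalSpan X).smul_mem c hT

theorem sum_mem_evalSpan {X κ : Type*} {s : Finset κ} {T : κ → (X → ℝ) → ℝ}
    (hT : ∀ k ∈ s, T k ∈ evalSpan X) : (fun f => ∑ k ∈ s, T k f) ∈ evalSpan X := by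
  have h : (fun f => ∑ k ∈ s, T k f) = ∑ k ∈ s, T k := by ext f; simp
  exact h ▸ Submodule.sum_mem _ hT

theorem increment_mem_evalSpan (x y : Set.Icc a b) :
    (fun f => increment f x y) ∈ evalSpan (Set.Icc a b) :=
  sum_mem_evalSpan fun _ _ => mul_mem_evalSpan (eval_mem_evalSpan _) _

omit [DecidableEq ι] in
/-- The indicator of a point is a product function, so a finite combination of point evaluations
is determined by its values on product functions. This reduces multivariate linear identities to
identities in one variable. -/
theorem eq_of_eq_on_prodFun {T T' : (Set.Icc a b → ℝ) → ℝ} (hT : T ∈ evalSpan (Set.Icc a b))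
    (hT' : T' ∈ evalSpan (Set.Icc a b)) (h : ∀ g, T (prodFun g) = T' (prodFun g))
    (f : Set.Icc a b → ℝ) : T f = T' f := by
  classical
  obtain ⟨c, hc⟩ := (Finsupp.mem_span_range_iff_exists_finsupp).1 (Submodule.sub_mem _ hT hT')
  have hT0 : ∀ f, T f - T' f = c.sum fun x r => r * f x := fun f => by
    have := congrFun hc f
    simp only [Finsupp.sum, Finset.sum_apply, Pi.smul_apply, smul_eq_mul, Pi.sub_apply] at this
    rw [← this, Finsupp.sum]
  have hc0 : c = 0 := by
    ext x
    -- test on the indicator of `x`, which picks out the coefficient at `x`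
    have h1 := hT0 (prodFun fun i z => if z = coord x i then 1 else 0)
    rw [h, sub_self] at h1
    have h2 : ∀ y : Set.Icc a b, prodFun (fun i z => if z = coord x i then (1 : ℝ) else 0) y =
        if y = x then 1 else 0 := by
      intro y
      rw [prodFun, Finset.prod_ite_zero]
      simp only [Finset.mem_univ, true_imp_iff, Finset.prod_const_one]
      exact if_congr ⟨ext_coord, fun e i => by rw [e]⟩ rfl rfl
    simp_rw [h2, mul_ite, mul_one, mul_zero] at h1
    simpa [Finsupp.sum, eq_comm] using h1
  have := hT0 f
  rw [hc0, Finsupp.sum_zero_index] at this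
  linarith

/-- The point of the hyperrectangle with the coordinates of `x` on `u` and those of the upper corner
`b` off `u`, that is `x^u : b^{-u}`. -/
def faceExtend (hab : a ≤ b) (u : Finset ι)
    (x : Set.Icc (fun i : u => a i) (fun i : u => b i)) : Set.Icc a b :=
  boxPoint fun i => if h : i ∈ u then coord x ⟨i, h⟩ else ⟨b i, hab i, le_rfl⟩

omit [Fintype ι] in
theorem faceRestrict_apply (hab : a ≤ b) (f : Set.Icc a b → ℝ) (u : Finset ι)
    (x : Set.Icc (fun i : u => a i) (fun i : u => b i)) :
    faceRestrict hab f u x = f (faceExtend hab u x) := rfl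

theorem faceRestrict_prodFun (hab : a ≤ b) (g : ∀ i, Set.Icc (a i) (b i) → ℝ) (u : Finset ι)
    (x : Set.Icc (fun i : u => a i) (fun i : u => b i)) :
    faceRestrict hab (prodFun g) u x =
      (∏ i ∈ uᶜ, g i ⟨b i, hab i, le_rfl⟩) * prodFun (fun i : u => g i) x := by
  rw [faceRestrict_apply, prodFun, ← Finset.prod_mul_prod_compl u, mul_comm]
  congr 1
  · refine Finset.prod_congr rfl fun i hi => ?_
    rw [Finset.mem_compl] at hi
    simp [faceExtend, hi]
  · rw [prodFun, ← Finset.prod_coe_sort u]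
    exact Finset.prod_congr rfl fun i _ => by simp [faceExtend]

theorem increment_faceRestrict_prodFun (hab : a ≤ b) (g : ∀ i, Set.Icc (a i) (b i) → ℝ)
    (u : Finset ι) (x y : Set.Icc (fun i : u => a i) (fun i : u => b i)) :
    increment (faceRestrict hab (prodFun g) u) x y =
      (∏ i ∈ uᶜ, g i ⟨b i, hab i, le_rfl⟩) *
        ∏ i : u, (g i (coord y i) - g i (coord x i)) := by
  rw [← increment_prodFun (fun i : u => g i), increment, increment, Finset.mul_sum]
  refine Finset.sum_congr rfl fun v _ => ?_
  rw [faceRestrict_prodFun]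
  ring

omit [Fintype ι] in
theorem increment_faceRestrict_mem_evalSpan (hab : a ≤ b) (u : Finset ι)
    (x y : Set.Icc (fun i : u => a i) (fun i : u => b i)) :
    (fun f => increment (faceRestrict hab f u) x y) ∈ evalSpan (Set.Icc a b) :=
  sum_mem_evalSpan fun _ _ => mul_mem_evalSpan (eval_mem_evalSpan (faceExtend hab u _)) _

theorem increment_add (f g : Set.Icc a b → ℝ) (x y : Set.Icc a b) :
    increment (f + g) x y = increment f x y + increment g x y := by
  simp [increment, mul_add, Finset.sum_add_distrib]

theorem increment_smul (c : ℝ) (f : Set.Icc a b → ℝ) (x y : Set.Icc a b) :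
    increment (c • f) x y = c * increment f x y := by
  simp [increment, Finset.mul_sum, mul_left_comm]

theorem abs_increment_le {f : Set.Icc a b → ℝ} {C : ℝ} (hf : ∀ x, |f x| ≤ C) (x y : Set.Icc a b) :
    |increment f x y| ≤ 2 ^ Fintype.card ι * C := by
  calc |increment f x y| ≤ ∑ _v : Finset ι, C := by
        refine (Finset.abs_sum_le_sum_abs _ _).trans (Finset.sum_le_sum fun v _ => ?_)
        rw [abs_mul, abs_pow, abs_neg, abs_one, one_pow, one_mul]
        exact hf _
    _ = _ := by simp

/-- The increment over a cell that is degenerate in some direction vanishes. -/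
theorem increment_eq_zero (f : Set.Icc a b → ℝ) {x y : Set.Icc a b} {i : ι}
    (h : coord x i = coord y i) : increment f x y = 0 :=
  eq_of_eq_on_prodFun (T' := 0) (increment_mem_evalSpan x y) (Submodule.zero_mem _)
    (fun g => by
      rw [increment_prodFun]
      exact Finset.prod_eq_zero (Finset.mem_univ i) (by rw [h, sub_self])) f

/-- On the full face, indexed by the subtype of all coordinates, the grid variation is that of `f`
itself. -/
theorem gridVariation_faceRestrict_univ (hab : a ≤ b) (f : Set.Icc a b → ℝ)
    (Y : ∀ i, Ladder (a i) (b i)) :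
    gridVariation (faceRestrict hab f Finset.univ) (fun i => Y i) = gridVariation f Y := by
  refine Finset.sum_nbij' (fun k i => k ⟨i, Finset.mem_univ i⟩) (fun k i => k i) ?_ ?_ ?_ ?_ ?_
  · intro k hk
    simp only [cells, Fintype.mem_piFinset] at hk ⊢
    exact fun i => hk ⟨i, Finset.mem_univ i⟩
  · intro k hk
    simp only [cells, Fintype.mem_piFinset] at hk ⊢
    exact fun i => hk i
  · intros; rfl
  · intros; rfl
  · intro k _
    congr 1
    refine eq_of_eq_on_prodFun (increment_faceRestrict_mem_evalSpan hab _ _ _)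
      (increment_mem_evalSpan _ _) (fun g => ?_) f
    rw [increment_faceRestrict_prodFun, increment_prodFun, Finset.compl_univ, Finset.prod_empty,
      one_mul]
    exact Finset.prod_coe_sort Finset.univ fun i =>
      g i ((Y i).pt (k ⟨i, Finset.mem_univ i⟩ + 1)) - g i ((Y i).pt (k ⟨i, Finset.mem_univ i⟩))

end Algebra

/-! ### Refinement of grids -/

section Refinement

/-- The ladder `R` refines the ladder `Y`, the interval `[R.pt q, R.pt (q + 1)]` being allotted to
`[Y.pt (κ q), Y.pt (κ q + 1)]`: the increment of every function over an interval of `Y` is the sum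
of its increments over the intervals allotted to it. -/
structure Refines {s t : ℝ} (Y R : Ladder s t) (κ : ℕ → ℕ) : Prop where
  lt_size : ∀ q < R.size, κ q < Y.size
  sum_eq : ∀ k < Y.size, ∀ f : Set.Icc s t → ℝ,
    ∑ q ∈ Finset.range R.size with κ q = k, (f (R.pt (q + 1)) - f (R.pt q)) =
      f (Y.pt (k + 1)) - f (Y.pt k)

theorem Ladder.pt_zero_le {s t : ℝ} (Y : Ladder s t) (x : Set.Icc s t) : Y.pt 0 ≤ x :=
  Subtype.coe_le_coe.1 (Y.pt_zero.trans_le x.2.1)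

theorem Ladder.le_pt_size {s t : ℝ} (Y : Ladder s t) (x : Set.Icc s t) : x ≤ Y.pt Y.size :=
  Subtype.coe_le_coe.1 (x.2.2.trans_eq Y.pt_size.symm)

/-- The points of `Z` truncated to the `k`-th interval of `Y`. -/
def Ladder.clamp {s t : ℝ} (Y Z : Ladder s t) (k j : ℕ) : Set.Icc s t :=
  max (Y.pt k) (min (Y.pt (k + 1)) (Z.pt j))

theorem Ladder.clamp_zero {s t : ℝ} (Y Z : Ladder s t) (k : ℕ) : Y.clamp Z k 0 = Y.pt k := by
  have := Z.pt_zero_le (Y.pt k)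
  exact max_eq_left ((min_le_right _ _).trans this)

theorem Ladder.clamp_size {s t : ℝ} (Y Z : Ladder s t) (k : ℕ) :
    Y.clamp Z k Z.size = Y.pt (k + 1) := by
  rw [clamp, min_eq_left (Z.le_pt_size _), max_eq_right (Y.mono k.le_succ)]

theorem Ladder.clamp_mono {s t : ℝ} (Y Z : Ladder s t) (k : ℕ) : Monotone (Y.clamp Z k) :=
  fun _ _ h => max_le_max le_rfl (min_le_min le_rfl (Z.mono h))

/-- The points `Y.clamp Z k j`, in lexicographic order of the pairs `(k, j)`, form a ladder. The
successor of the point with index `q = k * Z.size + j` is `Y.clamp Z k (j + 1)`, also when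
`j + 1 = Z.size`. -/
theorem Ladder.clamp_succ {s t : ℝ} (Y Z : Ladder s t) (q : ℕ) :
    Y.clamp Z ((q + 1) / Z.size) ((q + 1) % Z.size) =
      Y.clamp Z (q / Z.size) (q % Z.size + 1) := by
  rcases Nat.eq_zero_or_pos Z.size with h0 | hpos
  · simp [h0]
  · by_cases h : q % Z.size + 1 = Z.size
    · have h1 : q + 1 = Z.size * (q / Z.size + 1) := by
        have := Nat.div_add_mod q Z.size
        rw [mul_add, mul_one]; omega
      have h2 : (q + 1) / Z.size = q / Z.size + 1 := by
        conv_lhs => rw [h1, Nat.mul_div_cancel_left _ hpos]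
      have h3 : (q + 1) % Z.size = 0 := by rw [h1, Nat.mul_mod_right]
      rw [h3, h2, h, clamp_zero, clamp_size]
    · have hlt : q % Z.size + 1 < Z.size := lt_of_le_of_ne (Nat.mod_lt q hpos) h
      have h1 : q + 1 = q % Z.size + 1 + Z.size * (q / Z.size) := by
        have := Nat.div_add_mod q Z.size
        omega
      have h2 : (q + 1) / Z.size = q / Z.size := by
        conv_lhs => rw [h1]
        rw [Nat.add_mul_div_left _ _ hpos, Nat.div_eq_of_lt hlt, zero_add]
      have h3 : (q + 1) % Z.size = q % Z.size + 1 := by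
        conv_lhs => rw [h1]
        rw [Nat.add_mul_mod_self_left, Nat.mod_eq_of_lt hlt]
      rw [h2, h3]

/-- The common refinement of `Y` and `Z`: each interval of `Y` is divided by the truncations of
the points of `Z`. -/
def Ladder.inf {s t : ℝ} (Y Z : Ladder s t) : Ladder s t where
  size := Y.size * Z.size
  pt q := Y.clamp Z (q / Z.size) (q % Z.size)
  mono := monotone_nat_of_le_succ fun q => by
    rw [Y.clamp_succ Z]
    exact Y.clamp_mono Z _ (Nat.le_succ _)
  pt_zero := by rw [Nat.zero_div, Nat.zero_mod, clamp_zero, Y.pt_zero]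
  pt_size := by
    -- a ladder of size `0` exists only on a degenerate interval
    rcases Nat.eq_zero_or_pos Z.size with h0 | hpos
    · have h : s = t := by
        have h1 := Z.pt_size
        rw [h0] at h1
        exact Z.pt_zero.symm.trans h1
      have := (Y.clamp Z (Y.size * Z.size / Z.size) (Y.size * Z.size % Z.size)).2
      exact le_antisymm this.2 (h ▸ this.1)
    · rw [Nat.mul_div_cancel _ hpos, Nat.mul_mod_left, clamp_zero, Y.pt_size]

theorem Ladder.refines_inf_left {s t : ℝ} (Y Z : Ladder s t) :
    Refines Y (Y.inf Z) (· / Z.size) where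
  lt_size q hq := Nat.div_lt_of_lt_mul (by rwa [mul_comm])
  sum_eq k hk f := by
    have hsum : ∑ q ∈ Finset.range (Y.inf Z).size with q / Z.size = k,
        (f ((Y.inf Z).pt (q + 1)) - f ((Y.inf Z).pt q)) =
        ∑ j ∈ Finset.range Z.size, (f (Y.clamp Z k (j + 1)) - f (Y.clamp Z k j)) := by
      refine Finset.sum_nbij' (· % Z.size) (fun j => j + Z.size * k) ?_ ?_ ?_ ?_ ?_
      · intro q hq
        simp only [Finset.mem_filter, Finset.mem_range, inf] at hq ⊢
        exact Nat.mod_lt _ (Nat.pos_of_mul_pos_left (Nat.zero_lt_of_lt hq.1))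
      · intro j hj
        simp only [Finset.mem_filter, Finset.mem_range, inf] at hj ⊢
        refine ⟨?_, ?_⟩
        · have : Z.size * (k + 1) ≤ Z.size * Y.size := Nat.mul_le_mul_left _ hk
          rw [mul_comm Y.size]
          rw [mul_add] at this
          omega
        · rw [Nat.add_mul_div_left _ _ (by omega), Nat.div_eq_of_lt hj, zero_add]
      · intro q hq
        rw [← (Finset.mem_filter.1 hq).2]
        exact Nat.mod_add_div q Z.size
      · intro j hj
        exact (Nat.add_mul_mod_self_left _ _ _).trans (Nat.mod_eq_of_lt (Finset.mem_range.1 hj))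
      · intro q hq
        rw [← (Finset.mem_filter.1 hq).2]
        simp only [inf, Y.clamp_succ Z]
    rw [hsum, Finset.sum_range_sub fun j => f (Y.clamp Z k j), clamp_zero, clamp_size]

/-- The increments of `f` over the parts of `[Y.pt 0, Z.pt j]` in the intervals of `Y` add up to the
increment over the whole. -/
theorem Ladder.sum_clamp_sub {s t : ℝ} (Y Z : Ladder s t) (j : ℕ) (f : Set.Icc s t → ℝ) :
    ∑ k ∈ Finset.range Y.size, (f (Y.clamp Z k j) - f (Y.pt k)) =
      f (Z.pt j) - f (Y.pt 0) := by
  have h : ∀ k, f (Y.clamp Z k j) - f (Y.pt k) =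
      f (min (Y.pt (k + 1)) (Z.pt j)) - f (min (Y.pt k) (Z.pt j)) := by
    intro k
    have hk := Y.mono k.le_succ
    rcases le_total (Y.pt k) (Z.pt j) with hz | hz
    · rw [clamp, max_eq_right (le_min hk hz), min_eq_left hz]
    · rw [clamp, min_eq_right (hz.trans hk), max_eq_left hz, min_eq_right hz, sub_self, sub_self]
  simp_rw [h]
  rw [Finset.sum_range_sub fun k => f (min (Y.pt k) (Z.pt j)), min_eq_right (Y.le_pt_size _),
    min_eq_left (Y.pt_zero_le _)]

theorem Ladder.refines_inf_right {s t : ℝ} (Y Z : Ladder s t) :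
    Refines Z (Y.inf Z) (· % Z.size) where
  lt_size q hq := Nat.mod_lt _ (Nat.pos_of_mul_pos_left (Nat.zero_lt_of_lt hq))
  sum_eq j hj f := by
    have hpos : 0 < Z.size := Nat.zero_lt_of_lt hj
    have hsum : ∑ q ∈ Finset.range (Y.inf Z).size with q % Z.size = j,
        (f ((Y.inf Z).pt (q + 1)) - f ((Y.inf Z).pt q)) =
        ∑ k ∈ Finset.range Y.size, (f (Y.clamp Z k (j + 1)) - f (Y.clamp Z k j)) := by
      refine Finset.sum_nbij' (· / Z.size) (fun k => j + Z.size * k) ?_ ?_ ?_ ?_ ?_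
      · intro q hq
        simp only [Finset.mem_filter, Finset.mem_range, inf] at hq ⊢
        exact Nat.div_lt_of_lt_mul (by rw [mul_comm]; exact hq.1)
      · intro k hk
        simp only [Finset.mem_filter, Finset.mem_range, inf] at hk ⊢
        refine ⟨?_, ?_⟩
        · have : Z.size * (k + 1) ≤ Z.size * Y.size := Nat.mul_le_mul_left _ hk
          rw [mul_comm Y.size]
          rw [mul_add] at this
          omega
        · rw [Nat.add_mul_mod_self_left, Nat.mod_eq_of_lt hj]
      · intro q hq
        rw [← (Finset.mem_filter.1 hq).2]
        exact Nat.mod_add_div q Z.size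
      · intro k _
        exact (Nat.add_mul_div_left _ _ hpos).trans (by rw [Nat.div_eq_of_lt hj, zero_add])
      · intro q hq
        rw [← (Finset.mem_filter.1 hq).2]
        simp only [inf, Y.clamp_succ Z]
    have h1 := Y.sum_clamp_sub Z (j + 1) f
    have h2 := Y.sum_clamp_sub Z j f
    rw [Finset.sum_sub_distrib] at h1 h2
    rw [hsum, Finset.sum_sub_distrib]
    linarith

/-- A nondegenerate interval of the common refinement lies in both intervals it is allotted to, so
these have a common point. -/
theorem Ladder.exists_common_point {s t : ℝ} (Y Z : Ladder s t) (q : ℕ) :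
    (Y.inf Z).pt q = (Y.inf Z).pt (q + 1) ∨ ∃ x,
      (Y.pt (q / Z.size) ≤ x ∧ x ≤ Y.pt (q / Z.size + 1)) ∧
      (Z.pt (q % Z.size) ≤ x ∧ x ≤ Z.pt (q % Z.size + 1)) := by
  rw [or_iff_not_imp_left]
  intro hne
  have hlt := lt_of_le_of_ne ((Y.inf Z).mono q.le_succ) hne
  simp only [inf] at hlt
  rw [Y.clamp_succ Z, clamp, clamp] at hlt
  refine ⟨min (Y.pt (q / Z.size + 1)) (Z.pt (q % Z.size + 1)), ⟨?_, min_le_left _ _⟩, ?_,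
    min_le_right _ _⟩
  · by_contra! h
    rw [max_eq_left h.le] at hlt
    exact (le_max_left _ _).not_gt hlt
  · by_contra! h
    refine hlt.not_ge (max_le_max le_rfl ?_)
    exact le_min (min_le_left _ _) h.le

variable {ι : Type*} [Fintype ι] [DecidableEq ι] {a b : ι → ℝ}

/-- A weighted sum of increments over a grid, written as a sum over a refinement of the grid. -/
theorem sum_cells_eq_of_refines {Y R : ∀ i, Ladder (a i) (b i)} {κ : ι → ℕ → ℕ}
    (h : ∀ i, Refines (Y i) (R i) (κ i)) (w : (ι → ℕ) → ℝ) (B : Set.Icc a b → ℝ) :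
    ∑ k ∈ cells Y, w k * increment B (gridPoint Y k) (gridPoint Y fun i => k i + 1) =
      ∑ q ∈ cells R, w (fun i => κ i (q i)) *
        increment B (gridPoint R q) (gridPoint R fun i => q i + 1) := by
  have hmaps : ∀ q ∈ cells R, (fun i => κ i (q i)) ∈ cells Y := fun q hq => by
    simp only [cells, Fintype.mem_piFinset, Finset.mem_range] at hq ⊢
    exact fun i => (h i).lt_size _ (hq i)
  rw [← Finset.sum_fiberwise_of_maps_to hmaps]
  refine Finset.sum_congr rfl fun k hk => ?_
  have hk' : ∀ i, k i < (Y i).size := by simpa [cells] using hk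
  have hfib : ((cells R).filter fun q => (fun i => κ i (q i)) = k) =
      Fintype.piFinset fun i => (Finset.range (R i).size).filter fun q => κ i q = k i := by
    ext q
    simp only [cells, Finset.mem_filter, Fintype.mem_piFinset, funext_iff, forall_and]
  -- for products, both sides factor into one-dimensional increments
  have hinc := eq_of_eq_on_prodFun
    (T := fun B => increment B (gridPoint Y k) (gridPoint Y fun i => k i + 1))
    (T' := fun B => ∑ q ∈ cells R with (fun i => κ i (q i)) = k,
      increment B (gridPoint R q) (gridPoint R fun i => q i + 1))
    (increment_mem_evalSpan _ _) (sum_mem_evalSpan fun _ _ => increment_mem_evalSpan _ _)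
    (fun g => by
      simp only [increment_prodFun, gridPoint, coord_boxPoint]
      rw [hfib, ← Finset.prod_univ_sum _ fun i q => g i ((R i).pt (q + 1)) - g i ((R i).pt q)]
      exact Finset.prod_congr rfl fun i _ => ((h i).sum_eq (k i) (hk' i) (g i)).symm) B
  rw [hinc, Finset.mul_sum]
  refine Finset.sum_congr rfl fun q hq => ?_
  rw [(Finset.mem_filter.1 hq).2]

/-- Riemann-Stieltjes sums over two tagged grids of mesh less than `δ` differ by at most the
oscillation of the integrand at scale `2δ` times the variation of the integrator. -/
theorem abs_rsSum_sub_le {A B : Set.Icc a b → ℝ} {V ε δ : ℝ} (hε : 0 ≤ ε)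
    (hV : ∀ Y, gridVariation B Y ≤ V)
    (hA : ∀ x y : Set.Icc a b, (∀ i, |x.1 i - y.1 i| ≤ 2 * δ) → |A x - A y| ≤ ε)
    {P Q : ∀ i, TaggedLadder (a i) (b i)}
    (hP : ∀ i, ∀ k < (P i).size, ((P i).pt (k + 1) : ℝ) - (P i).pt k < δ)
    (hQ : ∀ i, ∀ k < (Q i).size, ((Q i).pt (k + 1) : ℝ) - (Q i).pt k < δ) :
    |rsSum A B P - rsSum A B Q| ≤ ε * V := by
  set Y := fun i => (P i).toLadder
  set Z := fun i => (Q i).toLadder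
  set R := fun i => (Y i).inf (Z i)
  have h1 : rsSum A B P = _ :=
    sum_cells_eq_of_refines (fun i => (Y i).refines_inf_left (Z i))
      (fun k => A (boxPoint fun i => (P i).tag (k i))) B
  have h2 : rsSum A B Q = _ :=
    sum_cells_eq_of_refines (fun i => (Y i).refines_inf_right (Z i))
      (fun k => A (boxPoint fun i => (Q i).tag (k i))) B
  rw [h1, h2, ← Finset.sum_sub_distrib]
  refine le_trans ?_ (mul_le_mul_of_nonneg_left (hV R) hε)
  rw [gridVariation, Finset.mul_sum]
  refine (Finset.abs_sum_le_sum_abs _ _).trans (Finset.sum_le_sum fun q hq => ?_)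
  have hq' : ∀ i, q i < (R i).size := by simpa [cells] using hq
  rw [← sub_mul, abs_mul]
  -- degenerate cells do not contribute; on the others the two tags share a cell of either grid
  by_cases hdeg : ∃ i, (R i).pt (q i) = (R i).pt (q i + 1)
  · obtain ⟨i, hi⟩ := hdeg
    have h0 : increment B (gridPoint R q) (gridPoint R fun i => q i + 1) = 0 :=
      increment_eq_zero B (i := i) (by simpa [gridPoint] using hi)
    rw [h0, abs_zero, mul_zero, mul_zero]
  · refine mul_le_mul_of_nonneg_right (hA _ _ fun i => ?_) (abs_nonneg _)
    obtain ⟨x, hx, hx'⟩ :=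
      ((Y i).exists_common_point (Z i) (q i)).resolve_left fun h => hdeg ⟨i, h⟩
    have hk := ((Y i).refines_inf_left (Z i)).lt_size _ (hq' i)
    have hj := ((Y i).refines_inf_right (Z i)).lt_size _ (hq' i)
    have e1 := (P i).pt_le_tag _ hk
    have e2 := (P i).tag_le_pt _ hk
    have e3 := (Q i).pt_le_tag _ hj
    have e4 := (Q i).tag_le_pt _ hj
    have e5 := hP i _ hk
    have e6 := hQ i _ hj
    simp only [← Subtype.coe_le_coe, Y, Z] at hx hx' e1 e2 e3 e4 e5 e6
    simp only [boxPoint, abs_le]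
    constructor <;> linarith [hx.1, hx.2, hx'.1, hx'.2]

end Refinement

/-! ### Integration by parts -/

section Parts

/-- The ladder formed by the tags of a tagged ladder and the two endpoints. -/
def TaggedLadder.dual {s t : ℝ} (P : TaggedLadder s t) : Ladder s t where
  size := P.size + 1
  pt k := if k = 0 then P.pt 0 else if k ≤ P.size then P.tag (k - 1) else P.pt P.size
  mono := monotone_nat_of_le_succ fun k => by
    rcases Nat.eq_zero_or_pos k with rfl | hk
    · simpa using P.pt_zero_le _
    · by_cases h : k + 1 ≤ P.size
      · have h1 := P.tag_le_pt (k - 1) (by omega)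
        rw [Nat.sub_add_cancel hk] at h1
        simpa [hk.ne', h, (Nat.le_succ k).trans h] using h1.trans (P.pt_le_tag k h)
      · simpa [hk.ne', h] using P.le_pt_size _
  pt_zero := by simp [P.pt_zero]
  pt_size := by simp [P.pt_size]

/-- Summation by parts in one variable, with the integrator normalised to vanish at the left
endpoint and the integrand split off at the right endpoint. -/
theorem TaggedLadder.sum_by_parts {s t : ℝ} (P : TaggedLadder s t) (g h : Set.Icc s t → ℝ) :
    ∑ k ∈ Finset.range P.size, g (P.tag k) * (h (P.pt (k + 1)) - h (P.pt k)) =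
      ∑ k ∈ Finset.range P.dual.size,
        -(g (P.dual.pt (k + 1)) - g (P.dual.pt k)) * (h (P.pt k) - h (P.pt 0)) +
      g (P.pt P.size) * (h (P.pt P.size) - h (P.pt 0)) := by
  have htel := Finset.sum_range_sub (fun k => g (P.dual.pt k) * (h (P.pt k) - h (P.pt 0))) P.size
  have hlast : P.dual.pt (P.size + 1) = P.pt P.size := by simp [dual]
  have htag : ∀ k ∈ Finset.range P.size, g (P.tag k) * (h (P.pt (k + 1)) - h (P.pt k)) =
      g (P.dual.pt (k + 1)) * (h (P.pt (k + 1)) - h (P.pt 0)) -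
        g (P.dual.pt k) * (h (P.pt k) - h (P.pt 0)) +
      -(g (P.dual.pt (k + 1)) - g (P.dual.pt k)) * (h (P.pt k) - h (P.pt 0)) := by
    intro k hk
    have : P.dual.pt (k + 1) = P.tag k := by
      have := Finset.mem_range.1 hk
      simp [dual, this]
    rw [this]
    ring
  rw [Finset.sum_congr rfl htag, Finset.sum_add_distrib, htel]
  change _ = ∑ k ∈ Finset.range (P.size + 1), _ + _
  rw [Finset.sum_range_succ, hlast]
  ring

variable {ι : Type*} [Fintype ι] [DecidableEq ι] {a b : ι → ℝ}

/-- Integration by parts for Riemann-Stieltjes sums in several variables. For each set `u` of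
coordinates, the integrand is differenced in the coordinates in `u` and frozen at `b` off `u`. -/
theorem rsSum_by_parts (hab : a ≤ b) (A B : Set.Icc a b → ℝ)
    (P : ∀ i, TaggedLadder (a i) (b i)) :
    rsSum A B P = ∑ u : Finset ι, ∑ k ∈ cells (fun i : u => (P i).dual),
      (-1) ^ u.card * increment (faceRestrict hab A u) (gridPoint (fun i : u => (P i).dual) k)
          (gridPoint (fun i : u => (P i).dual) fun i => k i + 1) *
        increment B (boxPoint fun i => (P i).pt 0)
          (faceExtend hab u (gridPoint (fun i : u => (P i).toLadder) k)) := by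
  have hb : ∀ i, (⟨b i, hab i, le_rfl⟩ : Set.Icc (a i) (b i)) = (P i).pt (P i).size :=
    fun i => Subtype.ext (P i).pt_size.symm
  -- both sides are linear in `A` and in `B`; reduce to products, first in `A`, then in `B`
  refine eq_of_eq_on_prodFun (T := fun A => rsSum A B P) (T' := fun A => ∑ u : Finset ι,
    ∑ k ∈ cells (fun i : u => (P i).dual),
      (-1) ^ u.card * increment (faceRestrict hab A u) (gridPoint (fun i : u => (P i).dual) k)
          (gridPoint (fun i : u => (P i).dual) fun i => k i + 1) *
        increment B (boxPoint fun i => (P i).pt 0)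
          (faceExtend hab u (gridPoint (fun i : u => (P i).toLadder) k))) ?_ ?_ (fun g => ?_) A
  · refine sum_mem_evalSpan fun k _ => ?_
    simp_rw [mul_comm _ (increment B _ _)]
    exact mul_mem_evalSpan (eval_mem_evalSpan _) _
  · refine sum_mem_evalSpan fun u _ => sum_mem_evalSpan fun k _ => ?_
    simp_rw [mul_right_comm _ _ (increment B _ _)]
    exact mul_mem_evalSpan (increment_faceRestrict_mem_evalSpan hab u _ _) _
  refine eq_of_eq_on_prodFun (T := fun B => rsSum (prodFun g) B P) (T' := fun B =>
    ∑ u : Finset ι, ∑ k ∈ cells (fun i : u => (P i).dual),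
      (-1) ^ u.card * increment (faceRestrict hab (prodFun g) u)
          (gridPoint (fun i : u => (P i).dual) k)
          (gridPoint (fun i : u => (P i).dual) fun i => k i + 1) *
        increment B (boxPoint fun i => (P i).pt 0)
          (faceExtend hab u (gridPoint (fun i : u => (P i).toLadder) k))) ?_ ?_ (fun h => ?_) B
  · exact sum_mem_evalSpan fun k _ => mul_mem_evalSpan (increment_mem_evalSpan _ _) _
  · exact sum_mem_evalSpan fun u _ => sum_mem_evalSpan fun k _ =>
      mul_mem_evalSpan (increment_mem_evalSpan _ _) _
  have hL : rsSum (prodFun g) (prodFun h) P = ∏ i, ∑ k ∈ Finset.range (P i).size,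
      g i ((P i).tag k) * (h i ((P i).pt (k + 1)) - h i ((P i).pt k)) := by
    rw [Finset.prod_univ_sum]
    refine Finset.sum_congr rfl fun k _ => ?_
    simp only [increment_prodFun, prodFun, gridPoint, coord_boxPoint, Finset.prod_mul_distrib]
  simp only [hL, TaggedLadder.sum_by_parts, Finset.prod_add, Finset.powerset_univ]
  refine Finset.sum_congr rfl fun u _ => ?_
  rw [← Finset.prod_coe_sort u, Finset.prod_univ_sum, Finset.sum_mul]
  refine Finset.sum_congr rfl fun k _ => ?_
  rw [increment_faceRestrict_prodFun, increment_prodFun, ← Finset.prod_mul_prod_compl u,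
    ← Finset.prod_coe_sort u, ← Finset.compl_eq_univ_sdiff]
  have h1 : ∏ i ∈ uᶜ, (h i (coord (faceExtend hab u
      (gridPoint (fun i : u => (P i).toLadder) k)) i) -
        h i (coord (boxPoint fun i => (P i).pt 0) i)) =
      ∏ i ∈ uᶜ, (h i ((P i).pt (P i).size) - h i ((P i).pt 0)) :=
    Finset.prod_congr rfl fun i hi => by
      simp [faceExtend, Finset.mem_compl.1 hi, hb]
  rw [h1]
  simp only [faceExtend, gridPoint, coord_boxPoint, Finset.prod_mul_distrib, hb,
    Finset.coe_mem, dite_true, Finset.prod_neg, Finset.card_univ, Fintype.card_coe]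
  ring

/-- If `A` has bounded Hardy-Krause variation, its restriction to every face has bounded grid
variation. For `u = ∅`, which the Hardy-Krause variation leaves out, there is a single grid, and the
bound is `|A b|`. -/
theorem exists_gridVariation_faceRestrict_le (hab : a ≤ b) {A : Set.Icc a b → ℝ}
    (hA : hkVariation hab A < ∞) (u : Finset ι) :
    ∃ C, ∀ Y, gridVariation (faceRestrict hab A u) Y ≤ C := by
  rcases u.eq_empty_or_nonempty with rfl | hu
  · refine ⟨gridVariation (faceRestrict hab A ∅) fun i => (Finset.notMem_empty _ i.2).elim,
      fun Y => le_of_eq ?_⟩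
    congr 1
    exact funext fun i => (Finset.notMem_empty _ i.2).elim
  · have hfin : vitaliVariation (faceRestrict hab A u) < ∞ :=
      (Finset.single_le_sum (f := fun u => vitaliVariation (faceRestrict hab A u))
        (fun _ _ => zero_le) (Finset.mem_filter.2 ⟨Finset.mem_univ u, hu⟩)).trans_lt hA
    exact ⟨(vitaliVariation (faceRestrict hab A u)).toReal, fun Y =>
      (ENNReal.ofReal_le_iff_le_toReal hfin.ne).1
        (le_iSup (fun Y => ENNReal.ofReal (gridVariation (faceRestrict hab A u) Y)) Y)⟩

/-- Riemann-Stieltjes sums with an integrand of bounded Hardy-Krause variation are bounded by the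
supremum norm of the integrator, uniformly in the tagged grid. -/
theorem exists_abs_rsSum_le_of_hkVariation (hab : a ≤ b) {A : Set.Icc a b → ℝ}
    (hA : hkVariation hab A < ∞) :
    ∃ K, ∀ (B : Set.Icc a b → ℝ) (C : ℝ), (∀ x, |B x| ≤ C) → ∀ P, |rsSum A B P| ≤ K * C := by
  choose V hV using exists_gridVariation_faceRestrict_le hab hA
  have h2 : (0 : ℝ) ≤ 2 ^ Fintype.card ι := by positivity
  refine ⟨(∑ u : Finset ι, |V u|) * 2 ^ Fintype.card ι, fun B C hB P => ?_⟩
  have hC : 0 ≤ C := (abs_nonneg _).trans (hB (boxPoint fun i => (P i).pt 0))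
  rw [rsSum_by_parts hab, mul_assoc, Finset.sum_mul]
  refine (Finset.abs_sum_le_sum_abs _ _).trans (Finset.sum_le_sum fun u _ => ?_)
  refine (Finset.abs_sum_le_sum_abs _ _).trans ?_
  refine le_trans ?_ (mul_le_mul_of_nonneg_right
    ((hV u fun i : u => (P i).dual).trans (le_abs_self _)) (mul_nonneg h2 hC))
  rw [gridVariation, Finset.sum_mul]
  refine Finset.sum_le_sum fun k _ => ?_
  rw [abs_mul, abs_mul, abs_pow, abs_neg, abs_one, one_pow, one_mul]
  exact mul_le_mul_of_nonneg_left (abs_increment_le hB _ _) (abs_nonneg _)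

end Parts

/-! ### Existence and continuity of the integral -/

section Limits

theorem exists_taggedLadder {s t : ℝ} (h : s ≤ t) {δ : ℝ} (hδ : 0 < δ) :
    ∃ P : TaggedLadder s t, ∀ k < P.size, (P.pt (k + 1) : ℝ) - P.pt k < δ := by
  obtain ⟨n, hn⟩ := exists_nat_ge ((t - s) / (δ / 2))
  rw [div_le_iff₀ (half_pos hδ)] at hn
  have hmono : Monotone fun k : ℕ => Set.projIcc s t h (s + k * (δ / 2)) :=
    (Set.monotone_projIcc h).comp fun i j hij => by
      have : (i : ℝ) ≤ j := Nat.cast_le.2 hij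
      nlinarith
  refine ⟨{
    size := n
    pt := fun k => Set.projIcc s t h (s + k * (δ / 2))
    mono := hmono
    pt_zero := by simp
    pt_size := by rw [Set.projIcc_of_right_le h (by linarith)]
    tag := fun k => Set.projIcc s t h (s + k * (δ / 2))
    pt_le_tag := fun _ _ => le_rfl
    tag_le_pt := fun k _ => hmono k.le_succ }, fun k _ => ?_⟩
  have := LipschitzWith.projIcc h |>.dist_le_mul (s + (k + 1 : ℕ) * (δ / 2)) (s + k * (δ / 2))
  rw [Subtype.dist_eq, Real.dist_eq, Real.dist_eq, NNReal.coe_one, one_mul] at this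
  refine ((le_abs_self _).trans this).trans_lt ?_
  have he : s + (k + 1 : ℕ) * (δ / 2) - (s + k * (δ / 2)) = δ / 2 := by push_cast; ring
  rw [he, abs_of_pos (half_pos hδ)]
  exact half_lt_self hδ

/-- A bounded family of linear functionals has a limit along any filter, in the generalized sense
of a limit along an ultrafilter. It is the limit in the usual sense at every point of the closure
of the set where the latter exists. -/
theorem exists_generalized_limit {E Ω : Type*} [NormedAddCommGroup E] [NormedSpace ℝ E]
    (l : Filter Ω) [l.NeBot] (S : Ω → E →ₗ[ℝ] ℝ) (K : ℝ) (hS : ∀ ω x, |S ω x| ≤ K * ‖x‖) :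
    ∃ g : E →L[ℝ] ℝ, ∀ x ∈ closure {x | ∃ I, Tendsto (fun ω => S ω x) l (𝓝 I)},
      Tendsto (fun ω => S ω x) l (𝓝 (g x)) := by
  set U := Ultrafilter.of l
  have hU : (U : Filter Ω) ≤ l := Ultrafilter.of_le l
  have hex : ∀ x, ∃ I, Tendsto (fun ω => S ω x) U (𝓝 I) := fun x => by
    obtain ⟨I, -, hI⟩ := (isCompact_closedBall (0 : ℝ) (K * ‖x‖)).ultrafilter_le_nhds
      (U.map fun ω => S ω x) (le_principal_iff.2 <|
        Filter.mem_map.2 <| Filter.univ_mem' fun ω => by simpa using hS ω x)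
    exact ⟨I, hI⟩
  choose g hg using hex
  have hbound : ∀ x, |g x| ≤ K * ‖x‖ := fun x =>
    le_of_tendsto (hg x).abs (Eventually.of_forall fun ω => hS ω x)
  let G : E →L[ℝ] ℝ := LinearMap.mkContinuous
    { toFun := g
      map_add' := fun x y => tendsto_nhds_unique (hg (x + y)) (by
        simpa only [map_add] using (hg x).add (hg y))
      map_smul' := fun c x => tendsto_nhds_unique (hg (c • x)) (by
        simpa only [map_smul, RingHom.id_apply] using (hg x).const_smul c) } K hbound
  refine ⟨G, fun x hx => Metric.tendsto_nhds.2 fun ε hε => ?_⟩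
  obtain ⟨y, ⟨I, hI⟩, hxy⟩ := Metric.mem_closure_iff.1 hx (ε / (3 * (|K| + 1))) (by positivity)
  have hGy : G y = I := tendsto_nhds_unique (hg y) (hI.mono_left hU)
  have hsmall : K * ‖x - y‖ < ε / 3 := by
    rw [dist_eq_norm, lt_div_iff₀ (by positivity)] at hxy
    nlinarith [le_abs_self K, norm_nonneg (x - y)]
  filter_upwards [Metric.tendsto_nhds.1 hI (ε / 3) (by positivity)] with ω hω
  have h1 := (hS ω (x - y)).trans_lt hsmall
  have h2 : |G (x - y)| < ε / 3 := (hbound (x - y)).trans_lt hsmall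
  rw [map_sub, abs_lt] at h1 h2
  rw [Real.dist_eq, abs_lt] at hω ⊢
  constructor <;> linarith [h1.1, h1.2, h2.1, h2.2, hω.1, hω.2]

variable {ι : Type*} [Fintype ι] [DecidableEq ι] {a b : ι → ℝ}

/-- The filter of tagged grids whose mesh tends to zero. -/
def gridFilter (a b : ι → ℝ) : Filter (∀ i, TaggedLadder (a i) (b i)) :=
  ⨅ (δ : ℝ) (_ : 0 < δ), 𝓟 {P | ∀ i, ∀ k < (P i).size, ((P i).pt (k + 1) : ℝ) - (P i).pt k < δ}

omit [Fintype ι] [DecidableEq ι] in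
theorem hasBasis_gridFilter : (gridFilter a b).HasBasis (fun δ : ℝ => 0 < δ) fun δ =>
    {P | ∀ i, ∀ k < (P i).size, ((P i).pt (k + 1) : ℝ) - (P i).pt k < δ} :=
  hasBasis_biInf_principal' (fun δ hδ δ' hδ' => ⟨min δ δ', lt_min hδ hδ',
    fun _ h i k hk => (h i k hk).trans_le (min_le_left _ _),
    fun _ h i k hk => (h i k hk).trans_le (min_le_right _ _)⟩) ⟨1, one_pos⟩

omit [Fintype ι] [DecidableEq ι] in
theorem gridFilter_neBot (hab : a ≤ b) : (gridFilter a b).NeBot :=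
  hasBasis_gridFilter.neBot_iff.2 fun {_} hδ => by
    choose P hP using fun i => exists_taggedLadder (hab i) hδ
    exact ⟨P, hP⟩

theorem hasRSIntegral_iff_tendsto {A B : Set.Icc a b → ℝ} {I : ℝ} :
    HasRSIntegral A B I ↔ Tendsto (rsSum A B) (gridFilter a b) (𝓝 I) := by
  rw [hasBasis_gridFilter.tendsto_iff Metric.nhds_basis_ball]
  rfl

theorem HasRSIntegral.unique (hab : a ≤ b) {A B : Set.Icc a b → ℝ} {I J : ℝ}
    (hI : HasRSIntegral A B I) (hJ : HasRSIntegral A B J) : I = J :=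
  have := gridFilter_neBot hab
  tendsto_nhds_unique (hasRSIntegral_iff_tendsto.1 hI) (hasRSIntegral_iff_tendsto.1 hJ)

theorem HasRSIntegral.rsIntegral_eq (hab : a ≤ b) {A B : Set.Icc a b → ℝ} {I : ℝ}
    (hI : HasRSIntegral A B I) : rsIntegral A B = I := by
  have h : ∃ I, HasRSIntegral A B I := ⟨I, hI⟩
  rw [rsIntegral, dif_pos h]
  exact h.choose_spec.unique hab hI

theorem rsSum_add_left (A A' B : Set.Icc a b → ℝ) (P : ∀ i, TaggedLadder (a i) (b i)) :
    rsSum (A + A') B P = rsSum A B P + rsSum A' B P := by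
  simp [rsSum, add_mul, Finset.sum_add_distrib]

theorem rsSum_smul_left (c : ℝ) (A B : Set.Icc a b → ℝ) (P : ∀ i, TaggedLadder (a i) (b i)) :
    rsSum (c • A) B P = c * rsSum A B P := by
  simp [rsSum, Finset.mul_sum, mul_assoc]

theorem rsSum_add_right (A B B' : Set.Icc a b → ℝ) (P : ∀ i, TaggedLadder (a i) (b i)) :
    rsSum A (B + B') P = rsSum A B P + rsSum A B' P := by
  simp [rsSum, increment_add, mul_add, Finset.sum_add_distrib]

theorem rsSum_smul_right (c : ℝ) (A B : Set.Icc a b → ℝ) (P : ∀ i, TaggedLadder (a i) (b i)) :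
    rsSum A (c • B) P = c * rsSum A B P := by
  simp [rsSum, increment_smul, Finset.mul_sum, mul_left_comm]

theorem abs_rsSum_le {A B : Set.Icc a b → ℝ} {C V : ℝ} (hC : 0 ≤ C) (hA : ∀ x, |A x| ≤ C)
    (hV : ∀ Y, gridVariation B Y ≤ V) (P : ∀ i, TaggedLadder (a i) (b i)) :
    |rsSum A B P| ≤ C * V := by
  refine le_trans ?_ (mul_le_mul_of_nonneg_left (hV fun i => (P i).toLadder) hC)
  rw [gridVariation, Finset.mul_sum]
  refine (Finset.abs_sum_le_sum_abs _ _).trans (Finset.sum_le_sum fun k _ => ?_)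
  rw [abs_mul]
  exact mul_le_mul_of_nonneg_right (hA _) (abs_nonneg _)

theorem tendsto_rsSum_of_tendsto {Ω : Type*} {l : Filter Ω} {A B : Set.Icc a b → ℝ}
    {Bn : Ω → Set.Icc a b → ℝ} (h : ∀ x, Tendsto (fun n => Bn n x) l (𝓝 (B x)))
    (P : ∀ i, TaggedLadder (a i) (b i)) :
    Tendsto (fun n => rsSum A (Bn n) P) l (𝓝 (rsSum A B P)) :=
  tendsto_finsetSum _ fun _ _ =>
    (tendsto_finsetSum _ fun _ _ => (h _).const_mul _).const_mul _

omit [DecidableEq ι] in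
/-- Uniform continuity of a continuous function on the hyperrectangle. -/
theorem exists_modulus {A : Set.Icc a b → ℝ} (hA : Continuous A) {ε : ℝ} (hε : 0 < ε) :
    ∃ δ > 0, ∀ x y : Set.Icc a b, (∀ i, |x.1 i - y.1 i| ≤ 2 * δ) → |A x - A y| ≤ ε := by
  obtain ⟨δ, hδ, h⟩ :=
    Metric.uniformContinuous_iff.1 (CompactSpace.uniformContinuous_of_continuous hA) ε hε
  refine ⟨δ / 4, by positivity, fun x y hxy => (h (lt_of_le_of_lt ?_ (half_lt_self hδ))).le⟩
  rw [Subtype.dist_eq, dist_pi_le_iff (by positivity)]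
  exact fun i => (hxy i).trans (by linarith)

/-- Continuous functions are integrable with respect to functions of bounded Vitali variation. -/
theorem exists_hasRSIntegral (hab : a ≤ b) {A B : Set.Icc a b → ℝ} {V : ℝ} (hA : Continuous A)
    (hV : ∀ Y, gridVariation B Y ≤ V) : ∃ I, HasRSIntegral A B I := by
  have := gridFilter_neBot hab
  simp_rw [hasRSIntegral_iff_tendsto]
  refine CompleteSpace.complete (Metric.cauchy_iff.2 ⟨inferInstance, fun ε hε => ?_⟩)
  have hε' : 0 < ε / (|V| + 1) := by positivity
  obtain ⟨δ, hδ, h⟩ := exists_modulus hA hε'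
  refine ⟨_, image_mem_map (hasBasis_gridFilter.mem_of_mem hδ), ?_⟩
  rintro _ ⟨P, hP, rfl⟩ _ ⟨Q, hQ, rfl⟩
  rw [Real.dist_eq]
  refine (abs_rsSum_sub_le hε'.le hV h hP hQ).trans_lt ?_
  rw [div_mul_eq_mul_div, div_lt_iff₀ (by positivity)]
  nlinarith [le_abs_self V]

/-- The rate of convergence of Riemann-Stieltjes sums depends on the integrator only through its
variation. -/
theorem HasRSIntegral.abs_rsSum_sub_le (hab : a ≤ b) {A B : Set.Icc a b → ℝ} {I V ε δ : ℝ}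
    (hI : HasRSIntegral A B I) (hε : 0 ≤ ε) (hV : ∀ Y, gridVariation B Y ≤ V) (hδ : 0 < δ)
    (hA : ∀ x y : Set.Icc a b, (∀ i, |x.1 i - y.1 i| ≤ 2 * δ) → |A x - A y| ≤ ε)
    {P : ∀ i, TaggedLadder (a i) (b i)}
    (hP : ∀ i, ∀ k < (P i).size, ((P i).pt (k + 1) : ℝ) - (P i).pt k < δ) :
    |rsSum A B P - I| ≤ ε * V := by
  have := gridFilter_neBot hab
  refine le_of_tendsto ((hasRSIntegral_iff_tendsto.1 hI).const_sub (rsSum A B P)).abs ?_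
  filter_upwards [hasBasis_gridFilter.mem_of_mem hδ] with Q hQ
  exact HardyKrause.abs_rsSum_sub_le hε hV hA hP hQ

/-- The Hardy-Krause variation dominates the Vitali variation, which is its term for the full set
of coordinates. -/
theorem gridVariation_le_of_hkVariation_le [Nonempty ι] (hab : a ≤ b) {B : Set.Icc a b → ℝ}
    {M : ℝ≥0} (hB : hkVariation hab B ≤ M) (Y : ∀ i, Ladder (a i) (b i)) :
    gridVariation B Y ≤ M := by
  have h1 : ENNReal.ofReal (gridVariation B Y) ≤ hkVariation hab B := by
    rw [← gridVariation_faceRestrict_univ hab]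
    exact (le_iSup (fun Y => ENNReal.ofReal
      (gridVariation (faceRestrict hab B Finset.univ) Y)) _).trans
      (Finset.single_le_sum (f := fun u => vitaliVariation (faceRestrict hab B u))
        (fun _ _ => zero_le)
        (Finset.mem_filter.2 ⟨Finset.mem_univ Finset.univ, Finset.univ_nonempty⟩))
  have h2 := h1.trans hB
  exact (ENNReal.ofReal_le_iff_le_toReal ENNReal.coe_ne_top).1 h2

/-- Joint continuity of the integral on integrators of uniformly bounded variation: the integral
is close to a Riemann-Stieltjes sum uniformly in the integrator, and the sums over a fixed grid are
continuous under pointwise convergence of the integrator. -/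
theorem tendsto_rsIntegral (hab : a ≤ b) {V : ℝ} {α : C(Set.Icc a b, ℝ)}
    {αn : ℕ → C(Set.Icc a b, ℝ)} {B : Set.Icc a b → ℝ} {Bn : ℕ → Set.Icc a b → ℝ}
    {I : ℝ} {J : ℕ → ℝ} (hV : ∀ Y, gridVariation B Y ≤ V) (hVn : ∀ n Y, gridVariation (Bn n) Y ≤ V)
    (hα : Tendsto αn atTop (𝓝 α)) (hB : ∀ x, Tendsto (fun n => Bn n x) atTop (𝓝 (B x)))
    (hI : HasRSIntegral α B I) (hJ : ∀ n, HasRSIntegral (αn n) (Bn n) (J n)) :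
    Tendsto J atTop (𝓝 I) := by
  have := gridFilter_neBot hab
  choose J' hJ' using fun n => exists_hasRSIntegral hab α.continuous (hVn n)
  have hdiff : ∀ n, |J n - J' n| ≤ ‖αn n - α‖ * V := fun n => by
    refine le_of_tendsto ((hasRSIntegral_iff_tendsto.1 (hJ n)).sub
      (hasRSIntegral_iff_tendsto.1 (hJ' n))).abs (Eventually.of_forall fun P => ?_)
    have h : rsSum (αn n) (Bn n) P - rsSum α (Bn n) P = rsSum (αn n - α : C(_, ℝ)) (Bn n) P := by
      rw [sub_eq_iff_eq_add, ← rsSum_add_left, ← ContinuousMap.coe_add, sub_add_cancel]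
    rw [h]
    exact abs_rsSum_le (norm_nonneg _) (fun x => (αn n - α).norm_coe_le_norm x) (hVn n) P
  have hdiff0 : Tendsto (fun n => ‖αn n - α‖ * V) atTop (𝓝 0) := by
    have := (tendsto_iff_norm_sub_tendsto_zero.1 hα).mul_const V
    rwa [zero_mul] at this
  refine Metric.tendsto_nhds.2 fun ε hε => ?_
  have hε' : 0 < ε / (4 * (|V| + 1)) := by positivity
  have hsmall : ε / (4 * (|V| + 1)) * V < ε / 4 := by
    rw [div_mul_eq_mul_div, div_lt_div_iff₀ (by positivity) (by positivity)]
    nlinarith [le_abs_self V]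
  obtain ⟨δ, hδ, hmod⟩ := exists_modulus α.continuous hε'
  obtain ⟨P, hP⟩ := nonempty_of_mem (hasBasis_gridFilter (a := a) (b := b).mem_of_mem hδ)
  have h0 := hI.abs_rsSum_sub_le hab hε'.le hV hδ hmod hP
  filter_upwards [Metric.tendsto_nhds.1 hdiff0 (ε / 4) (by positivity),
    Metric.tendsto_nhds.1 (tendsto_rsSum_of_tendsto (A := α) hB P) (ε / 4) (by positivity)] with n h1 h2
  have h3 := (hJ' n).abs_rsSum_sub_le hab hε'.le (hVn n) hδ hmod hP
  have h4 := hdiff n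
  rw [Real.dist_eq, abs_lt] at h1 h2 ⊢
  rw [abs_le] at h0 h3 h4
  constructor <;> linarith [h0.1, h0.2, h1.1, h1.2, h2.1, h2.2, h3.1, h3.2, h4.1, h4.2]

end Limits

/-! ### Differentiability of the integration map -/

section Derivative

variable {d : ℕ} {a b : Fin d → ℝ}

theorem integrationMap_eq (hab : a ≤ b) {p : C(Set.Icc a b, ℝ) × BoundedFun a b} {I : ℝ}
    (h : HasRSIntegral p.1 p.2 I) : integrationMap p = I :=
  h.rsIntegral_eq hab

theorem hasRSIntegral_integrationMap [Nonempty (Fin d)] (hab : a ≤ b)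
    (p : C(Set.Icc a b, ℝ) × BoundedFun a b) (hB : hkVariation hab p.2 < ∞) :
    HasRSIntegral p.1 p.2 (integrationMap p) := by
  have hM : hkVariation hab p.2 ≤ (hkVariation hab p.2).toNNReal :=
    (ENNReal.coe_toNNReal hB.ne).ge
  obtain ⟨I, hI⟩ :=
    exists_hasRSIntegral hab p.1.continuous (gridVariation_le_of_hkVariation_le hab hM)
  rwa [integrationMap_eq hab hI]

/-- For `A` of bounded Hardy-Krause variation, integration by parts bounds `β ↦ ∫ A dβ` in the
supremum norm of `β`; it extends to a continuous functional on `ℓ^∞`, and the integral exists for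
`β` in the closure of the functions of bounded variation. -/
theorem exists_functional_integrator [Nonempty (Fin d)] (hab : a ≤ b) (A : C(Set.Icc a b, ℝ))
    (hA : hkVariation hab A < ∞) :
    ∃ g : BoundedFun a b →L[ℝ] ℝ,
      (∀ (β : BoundedFun a b) I, HasRSIntegral A β I → g β = I) ∧
      ∀ β ∈ closure {f : BoundedFun a b | hkVariation hab f < ∞}, HasRSIntegral A β (g β) := by
  have := gridFilter_neBot hab
  obtain ⟨K, hK⟩ := exists_abs_rsSum_le_of_hkVariation hab hA
  obtain ⟨g, hg⟩ := exists_generalized_limit (gridFilter a b)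
    (fun P =>
      { toFun := fun β : BoundedFun a b => rsSum A β P
        map_add' := fun β β' => rsSum_add_right A β β' P
        map_smul' := fun c β => rsSum_smul_right c A β P }) K
    fun P β => hK β ‖β‖ (fun x => lp.norm_apply_le_norm ENNReal.top_ne_zero β x) P
  refine ⟨g, fun β I hI => ?_, fun β hβ => hasRSIntegral_iff_tendsto.2 (hg β ?_)⟩
  · exact (hasRSIntegral_iff_tendsto.2 (hg β
      (subset_closure ⟨I, hasRSIntegral_iff_tendsto.1 hI⟩))).unique hab hI
  · refine closure_mono (fun f hf => ?_) hβ
    exact ⟨_, hasRSIntegral_iff_tendsto.1 (hasRSIntegral_integrationMap hab (A, f) hf)⟩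

theorem exists_functional_integrand [Nonempty (Fin d)] (hab : a ≤ b) (B : BoundedFun a b)
    {M : ℝ≥0} (hB : hkVariation hab B ≤ M) :
    ∃ g : C(Set.Icc a b, ℝ) →L[ℝ] ℝ, ∀ α : C(Set.Icc a b, ℝ), HasRSIntegral α B (g α) := by
  have := gridFilter_neBot hab
  have hV := gridVariation_le_of_hkVariation_le hab hB
  obtain ⟨g, hg⟩ := exists_generalized_limit (gridFilter a b)
    (fun P =>
      { toFun := fun α : C(Set.Icc a b, ℝ) => rsSum α B P
        map_add' := fun α α' => rsSum_add_left α α' B P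
        map_smul' := fun c α => rsSum_smul_left c α B P }) M
    fun P α => (abs_rsSum_le (norm_nonneg α) (fun x => α.norm_coe_le_norm x) hV P).trans_eq
      (mul_comm _ _)
  refine ⟨g, fun α => hasRSIntegral_iff_tendsto.2 (hg α (subset_closure ?_))⟩
  obtain ⟨I, hI⟩ := exists_hasRSIntegral hab α.continuous hV
  exact ⟨I, hasRSIntegral_iff_tendsto.1 hI⟩

/-- The difference quotient of the integration map is `∫ A dβₙ + ∫ αₙ dBₙ` with
`Bₙ = B + tₙ βₙ`. The first term converges by continuity in the supremum norm, the second because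
the `Bₙ` have uniformly bounded variation and converge to `B`. -/
theorem hasHadamardDeriv_integrationMap [Nonempty (Fin d)] (hab : a ≤ b) {M : ℝ≥0}
    {A : C(Set.Icc a b, ℝ)} {B : BoundedFun a b} (hB : hkVariation hab B ≤ M)
    {gA : BoundedFun a b →L[ℝ] ℝ} {gB : C(Set.Icc a b, ℝ) →L[ℝ] ℝ}
    (hgA : ∀ (β : BoundedFun a b) I, HasRSIntegral A β I → gA β = I)
    (hgB : ∀ α : C(Set.Icc a b, ℝ), HasRSIntegral α B (gB α)) :
    HasHadamardDeriv integrationMap (integrationDomain hab M) Set.univ (A, B)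
      (gB.coprod gA) := by
  intro t h h₀ _ ht0 ht hh hmem
  have hBn : ∀ n, hkVariation hab (B + t n • (h n).2 : BoundedFun a b) ≤ M := hmem
  have hint : ∀ (α : C(Set.Icc a b, ℝ)) n, HasRSIntegral α (B + t n • (h n).2 : BoundedFun a b)
      (integrationMap (α, B + t n • (h n).2)) := fun α n =>
    hasRSIntegral_integrationMap hab (α, _) ((hBn n).trans_lt ENNReal.coe_lt_top)
  have hAB := hasRSIntegral_integrationMap hab (A, B) (hB.trans_lt ENNReal.coe_lt_top)
  have hα : Tendsto (fun n => (h n).1) atTop (𝓝 h₀.1) := hh.fst_nhds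
  have hβ : Tendsto (fun n => (h n).2) atTop (𝓝 h₀.2) := hh.snd_nhds
  have hBlim : Tendsto (fun n => B + t n • (h n).2) atTop (𝓝 B) := by
    simpa using (ht.smul hβ).const_add B
  have hquot : ∀ n, (t n)⁻¹ • (integrationMap ((A, B) + t n • h n) - integrationMap (A, B)) =
      integrationMap ((h n).1, B + t n • (h n).2) + gA (h n).2 := fun n => by
    have h1 : integrationMap ((A, B) + t n • h n) =
        integrationMap (A, B + t n • (h n).2) +
          t n * integrationMap ((h n).1, B + t n • (h n).2) := by
      refine integrationMap_eq hab (hasRSIntegral_iff_tendsto.2 ?_)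
      refine ((hasRSIntegral_iff_tendsto.1 (hint A n)).add
        ((hasRSIntegral_iff_tendsto.1 (hint (h n).1 n)).const_mul (t n))).congr fun P => ?_
      rw [← rsSum_smul_left, ← rsSum_add_left]
      rfl
    have h2 : gA (h n).2 = (t n)⁻¹ * (integrationMap (A, B + t n • (h n).2) -
        integrationMap (A, B)) := by
      refine hgA _ _ (hasRSIntegral_iff_tendsto.2 ?_)
      refine (((hasRSIntegral_iff_tendsto.1 (hint A n)).sub
        (hasRSIntegral_iff_tendsto.1 hAB)).const_mul (t n)⁻¹).congr fun P => ?_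
      rw [lp.coeFn_add, lp.coeFn_smul, rsSum_add_right, rsSum_smul_right, add_sub_cancel_left,
        inv_mul_cancel_left₀ (ht0 n)]
    rw [h1, h2, smul_eq_mul]
    have := ht0 n
    field_simp
    ring
  simp_rw [hquot, ContinuousLinearMap.coprod_apply]
  refine Tendsto.add ?_ ((gA.continuous.tendsto _).comp hβ)
  refine tendsto_rsIntegral hab (gridVariation_le_of_hkVariation_le hab hB)
    (fun n => gridVariation_le_of_hkVariation_le hab (hBn n)) hα (fun x => ?_) (hgB h₀.1)
    fun n => hint (h n).1 n
  refine tendsto_iff_norm_sub_tendsto_zero.2 (squeeze_zero (fun _ => norm_nonneg _) (fun n => ?_)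
    (tendsto_iff_norm_sub_tendsto_zero.1 hBlim))
  exact lp.norm_apply_le_norm ENNReal.top_ne_zero (B + t n • (h n).2 - B) x

end Derivative

end HardyKrause

theorem mainTheorem7 (d : ℕ) (hd : 0 < d) (a b : Fin d → ℝ) (hab : a ≤ b) (M : ℝ≥0) :
    -- the integral of a continuous function against a function of bounded variation exists
    (∀ (A : C(Set.Icc a b, ℝ)) (B : HardyKrause.BoundedFun a b),
      HardyKrause.hkVariation hab B < ∞ →
        HardyKrause.HasRSIntegral A B (HardyKrause.integrationMap (A, B))) ∧
    -- differentiability of the integration map, and its derivative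
    ∀ (A : C(Set.Icc a b, ℝ)) (B : HardyKrause.BoundedFun a b),
      HardyKrause.hkVariation hab A < ∞ →
      HardyKrause.hkVariation hab B ≤ M →
      ∃ L : C(Set.Icc a b, ℝ) × HardyKrause.BoundedFun a b →L[ℝ] ℝ,
        HardyKrause.HasHadamardDeriv HardyKrause.integrationMap
          (HardyKrause.integrationDomain hab M) Set.univ (A, B) L ∧
        ∀ (α : C(Set.Icc a b, ℝ)) (β : HardyKrause.BoundedFun a b),
          β ∈ closure {f : HardyKrause.BoundedFun a b | HardyKrause.hkVariation hab f < ∞} →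
          ∃ I J : ℝ, HardyKrause.HasRSIntegral A β I ∧ HardyKrause.HasRSIntegral α B J ∧
            L (α, β) = I + J := by
  have : Nonempty (Fin d) := ⟨⟨0, hd⟩⟩
  refine ⟨fun A B hB => HardyKrause.hasRSIntegral_integrationMap hab (A, B) hB,
    fun A B hA hB => ?_⟩
  obtain ⟨gA, hgA, hgA'⟩ := HardyKrause.exists_functional_integrator hab A hA
  obtain ⟨gB, hgB⟩ := HardyKrause.exists_functional_integrand hab B hB
  refine ⟨gB.coprod gA, HardyKrause.hasHadamardDeriv_integrationMap hab hB hgA hgB,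
    fun α β hβ => ⟨gA β, gB α, hgA' β hβ, hgB α, ?_⟩⟩
  rw [ContinuousLinearMap.coprod_apply, add_comm]
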